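/- Let $A\in\mathbb R^{n\times n}$, $B\in\mathbb R^{n\times m}$, $\bar F\in\mathbb R^{m\times n}$, and let $\mu_1,\dots,\mu_v\in\mathbb R$ with $\sum_j\mu_j^2\neq 0$. Consider the $v$ subsystems $$x_{k+1}^i=Ax_k^i+Bu_k^i,\qquad i=1,\dots,v,\ k\ge 0,$$ with arbitrary initial states $x_0^i\in\mathbb R^n$, put $\bar x_k=\sum_i\mu_ix_k^i$ and $\bar u_k=\sum_i\mu_iu_k^i$, and impose the constraint $\bar u_k=\bar F\bar x_k$ for all $k\ge 0$. Let $$J=\sum_{i=1}^{v}\sum_{k=0}^{\infty}\big[(x_k^i)'Qx_k^i+(u_k^i)'Ru_k^i\big]\in[0,\infty],$$ where $Q\ge 0$ and $R>0$ are symmetric, $Q=C'C$, and $(A,C)$ is observable. The following assertions are equivalent. 1. The system is stabilizable subject to the constraint: there are constant matrices $L_i,\bar L_i\in\mathbb R^{m\times n}$ such that under $u_k^i=L_ix_k^i+\bar L_i\bar x_k$, for all initial states, the constraint holds for all $k$ and $\lim_{k\to\infty}x_k^i=0$ for all $i$. 2. $A+B\bar F$ is stable, i.e. all its complex eigenvalues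 have modulus less than $1$. 3. The coupled algebraic Riccati equations $$P=Q+A'PA-A'PB(R+B'PB)^{-1}B'PA,$$ $$\bar P=(A+B\bar F)'\bar P(A+B\bar F)+\bar F'(R+B'PB)\bar F+A'PB(R+B'PB)^{-1}B'PA+A'PB\bar F+\bar F'B'PA$$ have exactly one solution $(P,\bar P)$ in symmetric matrices with $P+\bar P\ge P>0$. In this case, with the solution $(P,\bar P)$ of 3, $K=-(R+B'PB)^{-1}B'PA$ and $\bar K=\bar F-K$, the controller $$u_k^i=Kx_k^i+\frac{\mu_i}{\sum_{j}\mu_j^2}\bar K\bar x_k$$ satisfies the constraint and stabilizes the system. Moreover, for all initial states it minimizes $J$ among all control sequences that satisfy the constraint, and the minimal cost is $$J^*=\sum_{i=1}^{v}(x_0^i)'Px_0^i+\frac{1}{\sum_{j}\mu_j^2}\,\bar x_0'\bar P\bar x_0 .$$ -/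

import Mathlib

open Matrix Filter Topology
open scoped ENNReal

namespace DistributedLQ

noncomputable section

/-- The weighted "average" `∑ i, μ i • z i` of the vectors `z 1, …, z v`. -/
def average {v d : ℕ} (μ : Fin v → ℝ) (z : Fin v → Fin d → ℝ) : Fin d → ℝ :=
  ∑ i, μ i • z i

/-- `x` is the state sequence produced by the control sequence `u` from the initial states `ξ`;
`x k i` and `u k i` are the state and the input of the `i`-th subsystem at time `k`. -/
def IsTrajectory {n m v : ℕ} (A : Matrix (Fin n) (Fin n) ℝ) (B : Matrix (Fin n) (Fin m) ℝ)
    (ξ : Fin v → Fin n → ℝ) (x : ℕ → Fin v → Fin n → ℝ) (u : ℕ → Fin v → Fin m → ℝ) : Prop :=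
  x 0 = ξ ∧ ∀ k i, x (k + 1) i = A *ᵥ x k i + B *ᵥ u k i

/-- The imposed constraint: the average control is `Fbar` times the average state, at all times. -/
def SatisfiesConstraint {n m v : ℕ} (μ : Fin v → ℝ) (Fbar : Matrix (Fin m) (Fin n) ℝ)
    (x : ℕ → Fin v → Fin n → ℝ) (u : ℕ → Fin v → Fin m → ℝ) : Prop :=
  ∀ k, average μ (u k) = Fbar *ᵥ average μ (x k)

/-- The infinite-horizon cost, with values in `[0, ∞]`. For `Q ≥ 0` and `R > 0` every summand is
a nonnegative real number, so `ENNReal.ofReal` does not alter it. -/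
def cost {n m v : ℕ} (Q : Matrix (Fin n) (Fin n) ℝ) (R : Matrix (Fin m) (Fin m) ℝ)
    (x : ℕ → Fin v → Fin n → ℝ) (u : ℕ → Fin v → Fin m → ℝ) : ℝ≥0∞ :=
  ∑ i, ∑' k, ENNReal.ofReal (x k i ⬝ᵥ Q *ᵥ x k i + u k i ⬝ᵥ R *ᵥ u k i)

/-- The linear distributed feedback with constant gains: subsystem `i` applies
`L i * (own state) + Lbar i * (average state)`. -/
def feedback {n m v : ℕ} (μ : Fin v → ℝ) (L Lbar : Fin v → Matrix (Fin m) (Fin n) ℝ)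
    (z : Fin v → Fin n → ℝ) : Fin v → Fin m → ℝ :=
  fun i => L i *ᵥ z i + Lbar i *ᵥ average μ z

/-- The states of the closed loop under the feedback with gains `L`, `Lbar`, started at `ξ`. -/
def closedLoopState {n m v : ℕ} (A : Matrix (Fin n) (Fin n) ℝ) (B : Matrix (Fin n) (Fin m) ℝ)
    (μ : Fin v → ℝ) (L Lbar : Fin v → Matrix (Fin m) (Fin n) ℝ) (ξ : Fin v → Fin n → ℝ) :
    ℕ → Fin v → Fin n → ℝ
  | 0 => ξ
  | k + 1 => fun i =>
      A *ᵥ closedLoopState A B μ L Lbar ξ k i +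
        B *ᵥ feedback μ L Lbar (closedLoopState A B μ L Lbar ξ k) i

/-- The inputs of the closed loop under the feedback with gains `L`, `Lbar`, started at `ξ`. -/
def closedLoopInput {n m v : ℕ} (A : Matrix (Fin n) (Fin n) ℝ) (B : Matrix (Fin n) (Fin m) ℝ)
    (μ : Fin v → ℝ) (L Lbar : Fin v → Matrix (Fin m) (Fin n) ℝ) (ξ : Fin v → Fin n → ℝ) :
    ℕ → Fin v → Fin m → ℝ :=
  fun k => feedback μ L Lbar (closedLoopState A B μ L Lbar ξ k)

/-- The feedback with gains `L`, `Lbar` respects the constraint with gain `Fbar` and makes the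
closed loop asymptotically stable: from all initial states, all subsystem states tend to `0`. -/
def Stabilizes {n m v : ℕ} (A : Matrix (Fin n) (Fin n) ℝ) (B : Matrix (Fin n) (Fin m) ℝ)
    (μ : Fin v → ℝ) (Fbar : Matrix (Fin m) (Fin n) ℝ)
    (L Lbar : Fin v → Matrix (Fin m) (Fin n) ℝ) : Prop :=
  ∀ ξ : Fin v → Fin n → ℝ,
    SatisfiesConstraint μ Fbar (closedLoopState A B μ L Lbar ξ)
        (closedLoopInput A B μ L Lbar ξ) ∧
      ∀ i, Tendsto (fun k => closedLoopState A B μ L Lbar ξ k i) atTop (𝓝 0)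

/-- Stabilizability by a linear distributed controller, subject to the constraint. -/
def Stabilizable {n m v : ℕ} (A : Matrix (Fin n) (Fin n) ℝ) (B : Matrix (Fin n) (Fin m) ℝ)
    (μ : Fin v → ℝ) (Fbar : Matrix (Fin m) (Fin n) ℝ) : Prop :=
  ∃ L Lbar : Fin v → Matrix (Fin m) (Fin n) ℝ, Stabilizes A B μ Fbar L Lbar

/-- Stability of a matrix in discrete time: all complex eigenvalues lie in the open unit disc. -/
def IsStable {n : ℕ} (M : Matrix (Fin n) (Fin n) ℝ) : Prop :=
  ∀ z ∈ spectrum ℂ (M.map (algebraMap ℝ ℂ)), ‖z‖ < 1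

/-- Observability of `(A, C)`: an initial state whose free output `C A ^ k x` vanishes identically
is zero. -/
def IsObservable {n p : ℕ} (A : Matrix (Fin n) (Fin n) ℝ) (C : Matrix (Fin p) (Fin n) ℝ) : Prop :=
  ∀ x : Fin n → ℝ, (∀ k : ℕ, C *ᵥ (A ^ k *ᵥ x) = 0) → x = 0

/-- `(P, Pbar)` solves the coupled algebraic Riccati equations. -/
def SolvesARE {n m : ℕ} (A : Matrix (Fin n) (Fin n) ℝ) (B : Matrix (Fin n) (Fin m) ℝ)
    (Fbar : Matrix (Fin m) (Fin n) ℝ) (Q : Matrix (Fin n) (Fin n) ℝ)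
    (R : Matrix (Fin m) (Fin m) ℝ) (P Pbar : Matrix (Fin n) (Fin n) ℝ) : Prop :=
  P = Q + Aᵀ * P * A - Aᵀ * P * B * (R + Bᵀ * P * B)⁻¹ * Bᵀ * P * A ∧
  Pbar = (A + B * Fbar)ᵀ * Pbar * (A + B * Fbar) + Fbarᵀ * (R + Bᵀ * P * B) * Fbar
    + Aᵀ * P * B * (R + Bᵀ * P * B)⁻¹ * Bᵀ * P * A + Aᵀ * P * B * Fbar + Fbarᵀ * Bᵀ * P * A

/-- A solution of the coupled Riccati equations with `P + Pbar ≥ P > 0`, in the order of symmetric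
matrices. -/
def IsPosDefSolution {n m : ℕ} (A : Matrix (Fin n) (Fin n) ℝ) (B : Matrix (Fin n) (Fin m) ℝ)
    (Fbar : Matrix (Fin m) (Fin n) ℝ) (Q : Matrix (Fin n) (Fin n) ℝ)
    (R : Matrix (Fin m) (Fin m) ℝ) (P Pbar : Matrix (Fin n) (Fin n) ℝ) : Prop :=
  SolvesARE A B Fbar Q R P Pbar ∧ P.PosDef ∧ ((P + Pbar) - P).PosSemidef

/-- The gain `K = -(R + B' P B)⁻¹ B' P A`. -/
def gainK {n m : ℕ} (A : Matrix (Fin n) (Fin n) ℝ) (B : Matrix (Fin n) (Fin m) ℝ)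
    (R : Matrix (Fin m) (Fin m) ℝ) (P : Matrix (Fin n) (Fin n) ℝ) : Matrix (Fin m) (Fin n) ℝ :=
  -((R + Bᵀ * P * B)⁻¹ * Bᵀ * P * A)

/-- The gain `Kbar = Fbar - K`. -/
def gainKbar {n m : ℕ} (A : Matrix (Fin n) (Fin n) ℝ) (B : Matrix (Fin n) (Fin m) ℝ)
    (Fbar : Matrix (Fin m) (Fin n) ℝ) (R : Matrix (Fin m) (Fin m) ℝ)
    (P : Matrix (Fin n) (Fin n) ℝ) : Matrix (Fin m) (Fin n) ℝ :=
  Fbar - gainK A B R P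

/-- The claimed optimal value `∑ i, ξ i' P ξ i + (∑ i, μ i ^ 2)⁻¹ ξbar' Pbar ξbar`. -/
def optimalValue {n v : ℕ} (μ : Fin v → ℝ) (P Pbar : Matrix (Fin n) (Fin n) ℝ)
    (ξ : Fin v → Fin n → ℝ) : ℝ :=
  ∑ i, ξ i ⬝ᵥ P *ᵥ ξ i + (1 / ∑ j, μ j ^ 2) * (average μ ξ ⬝ᵥ Pbar *ᵥ average μ ξ)

end

end DistributedLQ

/-! Write S = R + B'PB. For P ≥ 0, completing the square shows that `riccati A B Q R P` represents
the minimum over u of x'Qx + u'Ru + (Ax+Bu)'P(Ax+Bu), attained at u = Kx with excess (u-Kx)'S(u-Kx).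
The constraint prescribes the average of the vectors w_i = u^i - Kx^i: it equals Kbar xbar. By
Cauchy-Schwarz, ∑ w_i'S w_i is then least at w_i = (μ_i/∑μ_j²) Kbar xbar, where it equals (∑μ_j²)⁻¹
(Kbar xbar)'S(Kbar xbar). Since xbar evolves autonomously under A + B Fbar, accumulating this
unavoidable term leads to a Lyapunov equation, which is the second Riccati equation. So
`optimalValue` drops in each step by the stage cost minus the squared deviation from the feedback
(`optimalValue_step`), and telescoping yields the optimal cost.

For the equivalence: 1 → 2 holds because every vector is an average of initial states and the
average is driven by A + B Fbar. For 2 → 3, Fbar is a stabilizing gain for a single system, so value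
iteration is bounded and converges (`exists_posSemidef_riccati_eq`); observability gives uniqueness
and definiteness of P, and `Pbar` comes from the Lyapunov equation. For 3 → 1, nonnegativity of the
value makes the cost finite, and observability turns finite cost into convergence of the states
(`IsObservable.tendsto_zero_of_summable`). -/

namespace DistributedLQ

noncomputable section

/-! ### Real quadratic forms and polarization. -/

section QuadraticForms

variable {ι κ : Type*} [Fintype ι] [Fintype κ]

theorem transpose_eq_of_isHermitian {ι : Type*} {M : Matrix ι ι ℝ} (h : M.IsHermitian) : Mᵀ = M := by
  rw [← conjTranspose_eq_transpose_of_trivial]; exact h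

theorem isHermitian_of_transpose_eq {ι : Type*} {M : Matrix ι ι ℝ} (h : Mᵀ = M) : M.IsHermitian := by
  rw [IsHermitian, conjTranspose_eq_transpose_of_trivial]; exact h

theorem dotProduct_mulVec_comm_of_symm {M : Matrix ι ι ℝ} (h : Mᵀ = M) (x y : ι → ℝ) :
    x ⬝ᵥ M *ᵥ y = y ⬝ᵥ M *ᵥ x := by
  rw [dotProduct_mulVec, ← mulVec_transpose, h, dotProduct_comm]

theorem dotProduct_mul_mulVec (M : Matrix κ ι ℝ) (N : Matrix κ κ ℝ) (x y : ι → ℝ) :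
    x ⬝ᵥ (Mᵀ * N * M) *ᵥ y = (M *ᵥ x) ⬝ᵥ N *ᵥ (M *ᵥ y) := by
  rw [← mulVec_mulVec, ← mulVec_mulVec, dotProduct_mulVec, vecMul_transpose]

theorem quadratic_add {M : Matrix ι ι ℝ} (h : Mᵀ = M) (x y : ι → ℝ) :
    (x + y) ⬝ᵥ M *ᵥ (x + y) = x ⬝ᵥ M *ᵥ x + 2 * (y ⬝ᵥ M *ᵥ x) + y ⬝ᵥ M *ᵥ y := by
  rw [mulVec_add, dotProduct_add, add_dotProduct, add_dotProduct,
    dotProduct_mulVec_comm_of_symm h x y]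
  ring

theorem quadratic_nonneg {M : Matrix ι ι ℝ} (h : M.PosSemidef) (x : ι → ℝ) :
    0 ≤ x ⬝ᵥ M *ᵥ x := by
  simpa using h.dotProduct_mulVec_nonneg x

theorem quadratic_pos {M : Matrix ι ι ℝ} (h : M.PosDef) {x : ι → ℝ} (hx : x ≠ 0) :
    0 < x ⬝ᵥ M *ᵥ x := by
  simpa using h.dotProduct_mulVec_pos hx

theorem posSemidef_of_quadratic_nonneg {M : Matrix ι ι ℝ} (h : Mᵀ = M)
    (h0 : ∀ x : ι → ℝ, 0 ≤ x ⬝ᵥ M *ᵥ x) : M.PosSemidef :=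
  .of_dotProduct_mulVec_nonneg (isHermitian_of_transpose_eq h) fun x => by simpa using h0 x

theorem posDef_of_quadratic_pos {M : Matrix ι ι ℝ} (h : Mᵀ = M)
    (h0 : ∀ x : ι → ℝ, x ≠ 0 → 0 < x ⬝ᵥ M *ᵥ x) : M.PosDef :=
  .of_dotProduct_mulVec_pos (isHermitian_of_transpose_eq h) fun x hx => by simpa using h0 x hx

/-- Polarization on basis vectors. It reduces equality and convergence of symmetric matrices to that
of their quadratic forms. -/
theorem entry_eq_of_symm [DecidableEq ι] {M : Matrix ι ι ℝ} (h : Mᵀ = M) (i j : ι) :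
    M i j = ((Pi.single i 1 + Pi.single j 1) ⬝ᵥ M *ᵥ (Pi.single i 1 + Pi.single j 1)
      - Pi.single i 1 ⬝ᵥ M *ᵥ Pi.single i 1 - Pi.single j 1 ⬝ᵥ M *ᵥ Pi.single j 1) / 2 := by
  have hij : M j i = M i j := congrFun (congrFun h i) j
  rw [quadratic_add h]
  simp only [mulVec_single_one, single_dotProduct, one_mul, col_apply, hij]
  ring

theorem ext_of_quadratic_eq {M N : Matrix ι ι ℝ} (hM : Mᵀ = M) (hN : Nᵀ = N)
    (h : ∀ x : ι → ℝ, x ⬝ᵥ M *ᵥ x = x ⬝ᵥ N *ᵥ x) : M = N := by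
  classical
  ext i j
  rw [entry_eq_of_symm hM, entry_eq_of_symm hN]
  simp only [h]

theorem posSemidef_transpose_mul_mul {N : Matrix κ κ ℝ} (hN : N.PosSemidef) (M : Matrix κ ι ℝ) :
    (Mᵀ * N * M).PosSemidef := by
  simpa [conjTranspose_eq_transpose_of_trivial] using hN.conjTranspose_mul_mul_same M

/-- A quadratic form of a positive definite matrix dominates a multiple of the squared norm, so
convergence of its values to `0` forces convergence of the arguments. -/
theorem tendsto_zero_of_quadratic_tendsto_zero {M : Matrix ι ι ℝ} (hM : M.PosDef)
    {x : ℕ → ι → ℝ} (h : Tendsto (fun k => x k ⬝ᵥ M *ᵥ x k) atTop (𝓝 0)) :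
    Tendsto x atTop (𝓝 0) := by
  have hcont : Continuous fun y : ι → ℝ => y ⬝ᵥ M *ᵥ y := by fun_prop
  obtain ⟨c, hc, hcb⟩ : ∃ c > 0, ∀ y : ι → ℝ, c * ‖y‖ ^ 2 ≤ y ⬝ᵥ M *ᵥ y := by
    -- The constant is the minimum of the form on the compact unit sphere; the sphere is empty only
    -- when the space is zero.
    rcases (Metric.sphere (0 : ι → ℝ) 1).eq_empty_or_nonempty with he | hne
    · refine ⟨1, one_pos, fun y => ?_⟩
      have hy : y = 0 := by
        by_contra hy
        have : (‖y‖⁻¹ • y) ∈ Metric.sphere (0 : ι → ℝ) 1 := by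
          simp [norm_smul, inv_mul_cancel₀ (norm_ne_zero_iff.2 hy)]
        simp [he] at this
      simp [hy]
    · obtain ⟨y₀, hy₀, hmin⟩ := (isCompact_sphere (0 : ι → ℝ) 1).exists_isMinOn hne
        hcont.continuousOn
      have hy₀' : y₀ ≠ 0 := by rintro rfl; simp at hy₀
      refine ⟨_, quadratic_pos hM hy₀', fun y => ?_⟩
      by_cases hy : y = 0
      · simp [hy]
      have hn : ‖y‖ ≠ 0 := norm_ne_zero_iff.2 hy
      have hs : (‖y‖⁻¹ • y) ∈ Metric.sphere (0 : ι → ℝ) 1 := by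
        simp [norm_smul, inv_mul_cancel₀ hn]
      have h1 := hmin hs
      simp only [Set.mem_ofPred_eq, mulVec_smul, dotProduct_smul, smul_dotProduct,
        smul_eq_mul] at h1
      calc _ ≤ (‖y‖⁻¹ * (‖y‖⁻¹ * y ⬝ᵥ M *ᵥ y)) * ‖y‖ ^ 2 := by gcongr
        _ = _ := by field_simp
  rw [tendsto_zero_iff_norm_tendsto_zero]
  have hsq : Tendsto (fun k => ‖x k‖ ^ 2) atTop (𝓝 0) := by
    have h2 := h.const_mul c⁻¹
    rw [mul_zero] at h2
    refine squeeze_zero (fun k => by positivity) (fun k => ?_) h2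
    rw [le_inv_mul_iff₀ hc]
    exact hcb _
  simpa [Real.sqrt_sq] using hsq.sqrt

end QuadraticForms

/-! ### The Riccati operator as a one-step minimization. -/

section Riccati

variable {n m : ℕ} {A : Matrix (Fin n) (Fin n) ℝ} {B : Matrix (Fin n) (Fin m) ℝ}
  {Q : Matrix (Fin n) (Fin n) ℝ} {R : Matrix (Fin m) (Fin m) ℝ}
  {P : Matrix (Fin n) (Fin n) ℝ}

/-- The Riccati operator of the standard linear quadratic problem. -/
def riccati (A : Matrix (Fin n) (Fin n) ℝ) (B : Matrix (Fin n) (Fin m) ℝ)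
    (Q : Matrix (Fin n) (Fin n) ℝ) (R : Matrix (Fin m) (Fin m) ℝ)
    (P : Matrix (Fin n) (Fin n) ℝ) : Matrix (Fin n) (Fin n) ℝ :=
  Q + Aᵀ * P * A - Aᵀ * P * B * (R + Bᵀ * P * B)⁻¹ * Bᵀ * P * A

theorem posDef_inputWeight (hR : R.PosDef) (hP : P.PosSemidef) : (R + Bᵀ * P * B).PosDef :=
  hR.add_posSemidef (posSemidef_transpose_mul_mul hP B)

/-- The normal equation for the minimizing input. With its transpose below it keeps the inverse out
of the later algebra. -/
theorem inputWeight_mul_gainK (hR : R.PosDef) (hP : P.PosSemidef) :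
    (R + Bᵀ * P * B) * gainK A B R P = -(Bᵀ * P * A) := by
  have hS := (isUnit_iff_isUnit_det _).1 (posDef_inputWeight (B := B) hR hP).isUnit
  rw [gainK, Matrix.mul_neg, Matrix.mul_assoc _ P A, Matrix.mul_assoc _ Bᵀ,
    mul_nonsing_inv_cancel_left _ _ hS, Matrix.mul_assoc]

theorem transpose_gainK_mul_inputWeight (hR : R.PosDef) (hP : P.PosSemidef) :
    (gainK A B R P)ᵀ * (R + Bᵀ * P * B) = -(Aᵀ * P * B) := by
  have h := congrArg transpose (inputWeight_mul_gainK (A := A) (B := B) hR hP)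
  rw [transpose_mul, transpose_eq_of_isHermitian (posDef_inputWeight hR hP).1] at h
  rw [h]
  simp [transpose_mul, transpose_eq_of_isHermitian hP.1, Matrix.mul_assoc]

theorem transpose_gainK_mul_mul_gainK (hR : R.PosDef) (hP : P.PosSemidef) :
    (gainK A B R P)ᵀ * (R + Bᵀ * P * B) * gainK A B R P
      = Aᵀ * P * B * (R + Bᵀ * P * B)⁻¹ * Bᵀ * P * A := by
  rw [transpose_gainK_mul_inputWeight hR hP, gainK]
  simp [Matrix.mul_assoc]

theorem riccati_eq_sub (hR : R.PosDef) (hP : P.PosSemidef) :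
    riccati A B Q R P = Q + Aᵀ * P * A
      - (gainK A B R P)ᵀ * (R + Bᵀ * P * B) * gainK A B R P := by
  rw [transpose_gainK_mul_mul_gainK hR hP, riccati]

theorem transpose_riccati (hQ : Q.PosSemidef) (hR : R.PosDef) (hP : P.PosSemidef) :
    (riccati A B Q R P)ᵀ = riccati A B Q R P := by
  rw [riccati_eq_sub hR hP]
  simp only [transpose_sub, transpose_add, transpose_mul, transpose_transpose,
    transpose_eq_of_isHermitian hQ.1, transpose_eq_of_isHermitian hP.1,
    transpose_eq_of_isHermitian hR.1, Matrix.mul_assoc]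

/-- Completion of the square in the one-step cost. -/
theorem complete_square (hR : R.PosDef) (hP : P.PosSemidef) (x : Fin n → ℝ) (u : Fin m → ℝ) :
    x ⬝ᵥ Q *ᵥ x + u ⬝ᵥ R *ᵥ u + (A *ᵥ x + B *ᵥ u) ⬝ᵥ P *ᵥ (A *ᵥ x + B *ᵥ u)
      = x ⬝ᵥ riccati A B Q R P *ᵥ x
        + (u - gainK A B R P *ᵥ x) ⬝ᵥ (R + Bᵀ * P * B) *ᵥ (u - gainK A B R P *ᵥ x) := by
  have hS : (R + Bᵀ * P * B)ᵀ = R + Bᵀ * P * B :=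
    transpose_eq_of_isHermitian (posDef_inputWeight hR hP).1
  have hcross : u ⬝ᵥ (R + Bᵀ * P * B) *ᵥ (gainK A B R P *ᵥ x) = -((B *ᵥ u) ⬝ᵥ P *ᵥ (A *ᵥ x)) := by
    rw [mulVec_mulVec, inputWeight_mul_gainK hR hP, neg_mulVec, dotProduct_neg,
      ← mulVec_mulVec, ← mulVec_mulVec, dotProduct_mulVec, vecMul_transpose]
  rw [riccati_eq_sub hR hP, sub_mulVec, dotProduct_sub, add_mulVec, dotProduct_add,
    dotProduct_mul_mulVec, dotProduct_mul_mulVec, quadratic_add (transpose_eq_of_isHermitian hP.1),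
    sub_eq_add_neg u, quadratic_add hS, neg_dotProduct, mulVec_neg, dotProduct_neg, neg_dotProduct,
    dotProduct_mulVec_comm_of_symm hS (gainK A B R P *ᵥ x) u, hcross, add_mulVec R _ u,
    dotProduct_add u, dotProduct_mul_mulVec B]
  ring

/-- The dropped term in `complete_square` is nonnegative. Together with equality at the gain
`gainK`, this variational description gives positivity and monotonicity of the operator. -/
theorem quadratic_riccati_le (hR : R.PosDef) (hP : P.PosSemidef) (x : Fin n → ℝ)
    (u : Fin m → ℝ) :
    x ⬝ᵥ riccati A B Q R P *ᵥ x ≤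
      x ⬝ᵥ Q *ᵥ x + u ⬝ᵥ R *ᵥ u + (A *ᵥ x + B *ᵥ u) ⬝ᵥ P *ᵥ (A *ᵥ x + B *ᵥ u) := by
  rw [complete_square hR hP]
  exact le_add_of_nonneg_right (quadratic_nonneg (posDef_inputWeight hR hP).posSemidef _)

theorem quadratic_riccati_eq (hR : R.PosDef) (hP : P.PosSemidef) (x : Fin n → ℝ) :
    x ⬝ᵥ riccati A B Q R P *ᵥ x =
      x ⬝ᵥ Q *ᵥ x + (gainK A B R P *ᵥ x) ⬝ᵥ R *ᵥ (gainK A B R P *ᵥ x)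
        + (A *ᵥ x + B *ᵥ (gainK A B R P *ᵥ x)) ⬝ᵥ P *ᵥ
          (A *ᵥ x + B *ᵥ (gainK A B R P *ᵥ x)) := by
  rw [complete_square hR hP]
  simp

theorem posSemidef_riccati (hQ : Q.PosSemidef) (hR : R.PosDef) (hP : P.PosSemidef) :
    (riccati A B Q R P).PosSemidef := by
  refine posSemidef_of_quadratic_nonneg (transpose_riccati hQ hR hP) fun x => ?_
  rw [quadratic_riccati_eq hR hP]
  have := quadratic_nonneg hQ x
  have := quadratic_nonneg hR.posSemidef (gainK A B R P *ᵥ x)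
  have := quadratic_nonneg hP (A *ᵥ x + B *ᵥ (gainK A B R P *ᵥ x))
  positivity

theorem quadratic_riccati_mono {P' : Matrix (Fin n) (Fin n) ℝ} (hR : R.PosDef)
    (hP : P.PosSemidef) (hP' : P'.PosSemidef)
    (h : ∀ x : Fin n → ℝ, x ⬝ᵥ P *ᵥ x ≤ x ⬝ᵥ P' *ᵥ x) (x : Fin n → ℝ) :
    x ⬝ᵥ riccati A B Q R P *ᵥ x ≤ x ⬝ᵥ riccati A B Q R P' *ᵥ x := by
  rw [quadratic_riccati_eq hR hP']
  -- The minimizer for `P'` serves as a competitor for `P`.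
  refine (quadratic_riccati_le hR hP x (gainK A B R P' *ᵥ x)).trans ?_
  gcongr
  exact h _

/-- The inhomogeneous term of the second Riccati equation is a complete square. -/
theorem gainKbar_square (Fbar : Matrix (Fin m) (Fin n) ℝ) (hR : R.PosDef) (hP : P.PosSemidef) :
    Fbarᵀ * (R + Bᵀ * P * B) * Fbar + Aᵀ * P * B * (R + Bᵀ * P * B)⁻¹ * Bᵀ * P * A
        + Aᵀ * P * B * Fbar + Fbarᵀ * Bᵀ * P * A
      = (gainKbar A B Fbar R P)ᵀ * (R + Bᵀ * P * B) * gainKbar A B Fbar R P := by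
  rw [gainKbar, transpose_sub, Matrix.sub_mul, Matrix.mul_sub, Matrix.sub_mul, Matrix.sub_mul,
    transpose_gainK_mul_mul_gainK hR hP, transpose_gainK_mul_inputWeight hR hP,
    Matrix.mul_assoc Fbarᵀ _ (gainK A B R P), inputWeight_mul_gainK hR hP]
  simp only [Matrix.mul_neg, Matrix.neg_mul, Matrix.mul_assoc]
  abel

end Riccati

/-! ### Observability turns finite cost into convergence. -/

section Observability

variable {n m p : ℕ} {A : Matrix (Fin n) (Fin n) ℝ} {B : Matrix (Fin n) (Fin m) ℝ}
  {C : Matrix (Fin p) (Fin n) ℝ} {x : ℕ → Fin n → ℝ} {u : ℕ → Fin m → ℝ}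

/-- For an observable pair, a trajectory whose input and output tend to `0` tends to `0`. -/
theorem IsObservable.tendsto_zero (hobs : IsObservable A C)
    (hx : ∀ k, x (k + 1) = A *ᵥ x k + B *ᵥ u k)
    (hy : Tendsto (fun k => C *ᵥ x k) atTop (𝓝 0)) (hu : Tendsto u atTop (𝓝 0)) :
    Tendsto x atTop (𝓝 0) := by
  -- The functionals that tend to 0 along the trajectory. Because the input tends to 0, this space
  -- is invariant under φ ↦ φ ∘ A, so it contains all rows of C A^k; observability says that these
  -- have no common nonzero kernel vector, hence the space is everything.
  let W : Submodule ℝ (Module.Dual ℝ (Fin n → ℝ)) :=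
    { carrier := {φ | Tendsto (fun k => φ (x k)) atTop (𝓝 0)}
      add_mem' := fun {φ ψ} hφ hψ => by
        simpa using Tendsto.add hφ hψ
      zero_mem' := by simp
      smul_mem' := fun c φ hφ => by
        simpa using Tendsto.const_mul c hφ }
  have hW (φ : Module.Dual ℝ (Fin n → ℝ)) :
      φ ∈ W ↔ Tendsto (fun k => φ (x k)) atTop (𝓝 0) := Iff.rfl
  have hshift (φ : Module.Dual ℝ (Fin n → ℝ)) (hφ : φ ∈ W) : φ ∘ₗ A.mulVecLin ∈ W := by
    rw [hW] at hφ ⊢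
    have hBu : Tendsto (fun k => φ (B *ᵥ u k)) atTop (𝓝 0) := by
      have hc : Continuous fun w : Fin m → ℝ => φ (B *ᵥ w) :=
        (φ.continuous_of_finiteDimensional).comp (by fun_prop)
      simpa [Function.comp_def] using (hc.tendsto 0).comp hu
    have h := ((tendsto_add_atTop_iff_nat 1).2 hφ).sub hBu
    simpa [hx] using h
  have hrow (i : Fin p) (k : ℕ) : LinearMap.proj i ∘ₗ (C * A ^ k).mulVecLin ∈ W := by
    induction k with
    | zero =>
      rw [hW]
      simpa using tendsto_pi_nhds.1 hy i
    | succ k ih =>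
      have := hshift _ ih
      rwa [LinearMap.comp_assoc, ← mulVecLin_mul, Matrix.mul_assoc, ← pow_succ] at this
  have hbot : W.dualCoannihilator = ⊥ := by
    rw [Submodule.eq_bot_iff]
    intro y hy
    rw [Submodule.mem_dualCoannihilator] at hy
    refine hobs y fun k => ?_
    ext i
    simpa [mulVec_mulVec] using hy _ (hrow i k)
  have htop : W = ⊤ := by
    rw [← Subspace.dualCoannihilator_dualAnnihilator_eq (W := W), hbot,
      Submodule.dualAnnihilator_bot]
  refine tendsto_pi_nhds.2 fun i => ?_
  have : LinearMap.proj i ∈ W := htop ▸ Submodule.mem_top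
  exact (hW _).1 this

variable {Q : Matrix (Fin n) (Fin n) ℝ} {R : Matrix (Fin m) (Fin m) ℝ}

theorem quadratic_gram (hCQ : Cᵀ * C = Q) (y : Fin n → ℝ) :
    y ⬝ᵥ Q *ᵥ y = (C *ᵥ y) ⬝ᵥ (C *ᵥ y) := by
  rw [← hCQ, ← mulVec_mulVec, dotProduct_mulVec, vecMul_transpose]

/-- A trajectory of finite cost tends to `0`. -/
theorem IsObservable.tendsto_zero_of_summable (hobs : IsObservable A C) (hCQ : Cᵀ * C = Q)
    (hQ : Q.PosSemidef) (hR : R.PosDef) (hx : ∀ k, x (k + 1) = A *ᵥ x k + B *ᵥ u k)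
    (hs : Summable fun k => x k ⬝ᵥ Q *ᵥ x k + u k ⬝ᵥ R *ᵥ u k) :
    Tendsto x atTop (𝓝 0) := by
  have h0 := hs.tendsto_atTop_zero
  have hxq : Tendsto (fun k => x k ⬝ᵥ Q *ᵥ x k) atTop (𝓝 0) :=
    squeeze_zero (fun k => quadratic_nonneg hQ _)
      (fun k => le_add_of_nonneg_right (quadratic_nonneg hR.posSemidef _)) h0
  have hur : Tendsto (fun k => u k ⬝ᵥ R *ᵥ u k) atTop (𝓝 0) :=
    squeeze_zero (fun k => quadratic_nonneg hR.posSemidef _)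
      (fun k => le_add_of_nonneg_left (quadratic_nonneg hQ _)) h0
  refine hobs.tendsto_zero hx ?_ (tendsto_zero_of_quadratic_tendsto_zero hR hur)
  refine tendsto_zero_of_quadratic_tendsto_zero (PosDef.one (n := Fin p) (R := ℝ)) ?_
  simpa [quadratic_gram hCQ] using hxq

end Observability

/-! ### Telescoping of a value function against stage costs. -/

section Telescoping

variable {s V : ℕ → ℝ}

theorem sum_range_eq_of_telescoping (h : ∀ k, V k = s k + V (k + 1)) (N : ℕ) :
    ∑ k ∈ Finset.range N, s k = V 0 - V N := by
  rw [← neg_sub, ← Finset.sum_range_sub, ← Finset.sum_neg_distrib]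
  exact Finset.sum_congr rfl fun k _ => by linarith [h k]

/-- Needs only V ≥ 0. It comes before `hasSum_of_telescoping`: summability first yields, through
observability, the limit V → 0 that the exact sum requires. -/
theorem summable_of_telescoping (hs : ∀ k, 0 ≤ s k) (hV : ∀ k, 0 ≤ V k)
    (h : ∀ k, V k = s k + V (k + 1)) : Summable s :=
  summable_of_sum_range_le hs fun N => by
    rw [sum_range_eq_of_telescoping h]
    exact sub_le_self _ (hV N)

theorem hasSum_of_telescoping (hs : ∀ k, 0 ≤ s k) (hV : Tendsto V atTop (𝓝 0))
    (h : ∀ k, V k = s k + V (k + 1)) : HasSum s (V 0) := by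
  rw [hasSum_iff_tendsto_nat_of_nonneg hs]
  simp only [sum_range_eq_of_telescoping h]
  simpa using hV.const_sub (V 0)

theorem le_tsum_of_telescoping (hs : Summable s) (hV : Tendsto V atTop (𝓝 0))
    (h : ∀ k, V k ≤ s k + V (k + 1)) : V 0 ≤ ∑' k, s k := by
  have hle (N : ℕ) : V 0 - V N ≤ ∑ k ∈ Finset.range N, s k := by
    rw [← neg_sub, ← Finset.sum_range_sub, ← Finset.sum_neg_distrib]
    exact Finset.sum_le_sum fun k _ => by linarith [h k]
  have hlim : Tendsto (fun N => V 0 - V N) atTop (𝓝 (V 0)) := by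
    simpa using hV.const_sub (V 0)
  exact le_of_tendsto_of_tendsto' hlim hs.hasSum.tendsto_sum_nat hle

end Telescoping

theorem tendsto_quadratic_zero {n : ℕ} {x : ℕ → Fin n → ℝ} (P : Matrix (Fin n) (Fin n) ℝ)
    (hx : Tendsto x atTop (𝓝 0)) : Tendsto (fun k => x k ⬝ᵥ P *ᵥ x k) atTop (𝓝 0) := by
  have hc : Continuous fun y : Fin n → ℝ => y ⬝ᵥ P *ᵥ y := by fun_prop
  simpa [Function.comp_def] using (hc.tendsto 0).comp hx

/-! ### Stable matrices and the discrete Lyapunov equation. -/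

section Stability

variable {n : ℕ} {M : Matrix (Fin n) (Fin n) ℝ}

theorem isStable_of_tendsto_pow (h : ∀ x, Tendsto (fun k => M ^ k *ᵥ x) atTop (𝓝 0)) :
    IsStable M := by
  intro z hz
  rw [← spectrum_toLin', ← Module.End.hasEigenvalue_iff_mem_spectrum] at hz
  obtain ⟨w, hw⟩ := hz.exists_hasEigenvector
  have hMw : (M.map (algebraMap ℝ ℂ)) *ᵥ w = z • w := by simpa using hw.apply_eq_smul
  have hpow (k : ℕ) : ((M ^ k).map (algebraMap ℝ ℂ)) *ᵥ w = z ^ k • w := by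
    induction k with
    | zero => simp
    | succ k ih =>
      rw [pow_succ, Matrix.map_mul, ← mulVec_mulVec, hMw, mulVec_smul, ih, smul_smul, pow_succ']
  obtain ⟨i, hi⟩ : ∃ i, w i ≠ 0 := by
    by_contra! hc
    exact hw.2 (funext hc)
  -- The hypothesis concerns real vectors only, so it is applied to the real and imaginary parts of
  -- the complex eigenvector.
  have hre := tendsto_pi_nhds.1 (h fun j => (w j).re) i
  have him := tendsto_pi_nhds.1 (h fun j => (w j).im) i
  have hsum : Tendsto (fun k => z ^ k * w i) atTop (𝓝 0) := by
    have h1 := ((Complex.continuous_ofReal.tendsto _).comp hre).add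
      (((Complex.continuous_ofReal.tendsto _).comp him).mul_const Complex.I)
    simp only [Pi.zero_apply, Complex.ofReal_zero, zero_mul, add_zero] at h1
    refine h1.congr fun k => ?_
    have h2 := congrFun (hpow k) i
    simp only [Pi.smul_apply, smul_eq_mul] at h2
    rw [← h2]
    simp only [Function.comp_apply, mulVec, dotProduct, Complex.ofReal_sum, Complex.ofReal_mul,
      Finset.sum_mul, ← Finset.sum_add_distrib, map_apply, Complex.coe_algebraMap]
    refine Finset.sum_congr rfl fun j _ => ?_
    conv_rhs => rw [← Complex.re_add_im (w j)]
    ring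
  have hz' : Tendsto (fun k => z ^ k) atTop (𝓝 0) := by
    have := hsum.mul_const (w i)⁻¹
    simpa [mul_assoc, hi] using this
  exact tendsto_pow_atTop_nhds_zero_iff_norm_lt_one.1 hz'

attribute [local instance] Matrix.frobeniusNormedAddCommGroup Matrix.frobeniusNormedSpace
  Matrix.frobeniusNormedRing Matrix.frobeniusNormedAlgebra in
-- Gelfand's formula. The Frobenius norm is submultiplicative and unchanged both by passing to
-- complex entries and by transposing.
theorem IsStable.eventually_norm_pow_le (h : IsStable M) :
    ∃ r : ℝ, 0 ≤ r ∧ r < 1 ∧ ∀ᶠ k : ℕ in atTop, ‖M ^ k‖ ≤ r ^ k := by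
  rcases isEmpty_or_nonempty (Fin n) with hn | hn
  · exact ⟨0, le_rfl, one_pos, .of_forall fun k => by
      simp [Subsingleton.elim (M ^ k) 0]⟩
  have hlt : spectralRadius ℂ (M.map (algebraMap ℝ ℂ)) < (1 : NNReal) :=
    spectrum.spectralRadius_lt_of_forall_lt _ fun z hz => by exact_mod_cast h z hz
  obtain ⟨r, hr, hr1⟩ := ENNReal.lt_iff_exists_nnreal_btwn.1 hlt
  have hlim := spectrum.pow_nnnorm_pow_one_div_tendsto_nhds_spectralRadius
    (M.map (algebraMap ℝ ℂ))
  refine ⟨r, r.2, by exact_mod_cast hr1, ?_⟩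
  filter_upwards [hlim.eventually (gt_mem_nhds hr), eventually_gt_atTop 0] with k hk hk0
  have hnorm : ‖(M.map (algebraMap ℝ ℂ)) ^ k‖₊ = ‖M ^ k‖₊ := by
    rw [← Matrix.map_pow]
    exact frobenius_nnnorm_map_eq _ _ fun a => by simp
  rw [hnorm] at hk
  have hk' : (‖M ^ k‖₊ : ℝ≥0∞) ≤ (r : ℝ≥0∞) ^ k := by
    rw [← ENNReal.rpow_natCast]
    calc (‖M ^ k‖₊ : ℝ≥0∞) = ((‖M ^ k‖₊ : ℝ≥0∞) ^ (1 / (k : ℝ))) ^ (k : ℝ) := by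
          rw [← ENNReal.rpow_mul, one_div_mul_cancel (by positivity), ENNReal.rpow_one]
      _ ≤ _ := by gcongr
  exact_mod_cast hk'

attribute [local instance] Matrix.frobeniusNormedAddCommGroup Matrix.frobeniusNormedSpace
  Matrix.frobeniusNormedRing Matrix.frobeniusNormedAlgebra in
theorem IsStable.summable_transpose_pow_mul (h : IsStable M) (W : Matrix (Fin n) (Fin n) ℝ) :
    Summable fun k : ℕ => (M ^ k)ᵀ * W * M ^ k := by
  obtain ⟨r, hr0, hr1, hr⟩ := h.eventually_norm_pow_le
  have hgeo : Summable fun k : ℕ => ‖W‖ * (r ^ 2) ^ k :=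
    (summable_geometric_of_lt_one (by positivity) (by nlinarith)).mul_left _
  refine Summable.of_norm_bounded_eventually_nat hgeo ?_
  filter_upwards [hr] with k hk
  calc ‖(M ^ k)ᵀ * W * M ^ k‖ ≤ ‖(M ^ k)ᵀ‖ * ‖W‖ * ‖M ^ k‖ :=
        (norm_mul_le _ _).trans (by gcongr; exact norm_mul_le _ _)
    _ ≤ r ^ k * ‖W‖ * r ^ k := by
        rw [frobenius_norm_transpose]; gcongr
    _ = _ := by ring

/-- Solvability of the discrete Lyapunov equation for a stable matrix. -/
theorem IsStable.exists_lyapunov (h : IsStable M) {W : Matrix (Fin n) (Fin n) ℝ}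
    (hW : W.PosSemidef) :
    ∃ T : Matrix (Fin n) (Fin n) ℝ, T.PosSemidef ∧ T = Mᵀ * T * M + W := by
  have hsum := h.summable_transpose_pow_mul W
  have hterm (k : ℕ) : ((M ^ k)ᵀ * W * M ^ k).PosSemidef := posSemidef_transpose_mul_mul hW _
  -- The series satisfies the equation because splitting off its term k = 0 leaves Mᵀ T M.
  refine ⟨∑' k, (M ^ k)ᵀ * W * M ^ k, ?_, ?_⟩
  · refine posSemidef_of_quadratic_nonneg ?_ fun x => ?_
    · rw [transpose_tsum]
      exact tsum_congr fun k => transpose_eq_of_isHermitian (hterm k).1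
    · have hc : Continuous fun T : Matrix (Fin n) (Fin n) ℝ => x ⬝ᵥ T *ᵥ x := by fun_prop
      refine ge_of_tendsto' ((hc.tendsto _).comp hsum.hasSum.tendsto_sum_nat) fun N => ?_
      exact quadratic_nonneg (posSemidef_sum _ fun k _ => hterm k) x
  · conv_lhs => rw [hsum.tsum_eq_zero_add]
    rw [pow_zero, transpose_one, Matrix.one_mul, Matrix.mul_one, add_comm]
    congr 1
    rw [← hsum.tsum_mul_left, ← (hsum.mul_left Mᵀ).tsum_mul_right]
    exact tsum_congr fun k => by simp only [pow_succ, transpose_mul, Matrix.mul_assoc]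

/-- Iterating the equation gives D = (M^k)ᵀ D M^k for all k, and the right side tends to 0. -/
theorem IsStable.eq_zero_of_lyapunov (h : IsStable M) {D : Matrix (Fin n) (Fin n) ℝ}
    (hD : D = Mᵀ * D * M) : D = 0 := by
  have hpow (k : ℕ) : (M ^ k)ᵀ * D * M ^ k = D := by
    induction k with
    | zero => simp
    | succ k ih =>
      calc _ = Mᵀ * ((M ^ k)ᵀ * D * M ^ k) * M := by
            rw [pow_succ, transpose_mul]; simp only [Matrix.mul_assoc]
        _ = D := by rw [ih, ← hD]
  have := (h.summable_transpose_pow_mul D).tendsto_atTop_zero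
  simp only [hpow] at this
  exact tendsto_nhds_unique tendsto_const_nhds this

end Stability

/-! ### The algebraic Riccati equation of a single system. -/

section AlgebraicRiccati

variable {n m p : ℕ} {A : Matrix (Fin n) (Fin n) ℝ} {B : Matrix (Fin n) (Fin m) ℝ}
  {Q : Matrix (Fin n) (Fin n) ℝ} {R : Matrix (Fin m) (Fin m) ℝ} {C : Matrix (Fin p) (Fin n) ℝ}
  {P : Matrix (Fin n) (Fin n) ℝ}

theorem continuousAt_riccati (hR : R.PosDef) (hP : P.PosSemidef) :
    ContinuousAt (riccati A B Q R) P := by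
  have hdet : (R + Bᵀ * P * B).det ≠ 0 :=
    ((isUnit_iff_isUnit_det _).1 (posDef_inputWeight hR hP).isUnit).ne_zero
  have hinv : ContinuousAt (fun X : Matrix (Fin n) (Fin n) ℝ => (R + Bᵀ * X * B)⁻¹) P := by
    have h1 : ContinuousAt Inv.inv (R + Bᵀ * P * B) := by
      refine continuousAt_matrix_inv _ ?_
      rw [Ring.inverse_eq_inv']
      exact continuousAt_inv₀ hdet
    have h2 : Continuous fun X : Matrix (Fin n) (Fin n) ℝ => R + Bᵀ * X * B := by fun_prop
    exact ContinuousAt.comp (f := fun X : Matrix (Fin n) (Fin n) ℝ => R + Bᵀ * X * B)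
      h1 h2.continuousAt
  have hmul : ∀ {a b c : ℕ} {f : Matrix (Fin n) (Fin n) ℝ → Matrix (Fin a) (Fin b) ℝ}
      {g : Matrix (Fin n) (Fin n) ℝ → Matrix (Fin b) (Fin c) ℝ},
      ContinuousAt f P → ContinuousAt g P → ContinuousAt (fun X => f X * g X) P := by
    intro a b c f g hf hg
    have hc : Continuous fun Y : Matrix (Fin a) (Fin b) ℝ × Matrix (Fin b) (Fin c) ℝ =>
      Y.1 * Y.2 := by fun_prop
    exact hc.continuousAt.comp (hf.prodMk hg)
  have hid : ContinuousAt (fun X : Matrix (Fin n) (Fin n) ℝ => X) P := continuousAt_id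
  unfold riccati
  refine ContinuousAt.sub (continuousAt_const.add
    (hmul (hmul continuousAt_const hid) continuousAt_const)) ?_
  exact hmul (hmul (hmul (hmul (hmul (hmul continuousAt_const hid) continuousAt_const) hinv)
    continuousAt_const) hid) continuousAt_const

/-- A sequence of symmetric matrices that is monotone and bounded in the sense of quadratic forms
converges. -/
theorem exists_tendsto_of_quadratic_monotone {X : ℕ → Matrix (Fin n) (Fin n) ℝ}
    {T : Matrix (Fin n) (Fin n) ℝ} (hX : ∀ k, (X k)ᵀ = X k)
    (hmono : ∀ x : Fin n → ℝ, Monotone fun k => x ⬝ᵥ X k *ᵥ x)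
    (hle : ∀ k (x : Fin n → ℝ), x ⬝ᵥ X k *ᵥ x ≤ x ⬝ᵥ T *ᵥ x) :
    ∃ L, Tendsto X atTop (𝓝 L) := by
  have hq (x : Fin n → ℝ) : ∃ l, Tendsto (fun k => x ⬝ᵥ X k *ᵥ x) atTop (𝓝 l) :=
    ⟨_, tendsto_atTop_ciSup (hmono x) ⟨_, by rintro _ ⟨k, rfl⟩; exact hle k x⟩⟩
  choose l hl using hq
  refine ⟨of fun i j => (l (Pi.single i 1 + Pi.single j 1) - l (Pi.single i 1)
    - l (Pi.single j 1)) / 2, ?_⟩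
  refine tendsto_pi_nhds.2 fun i => tendsto_pi_nhds.2 fun j => ?_
  simp only [fun k => entry_eq_of_symm (hX k) i j]
  exact (((hl _).sub (hl _)).sub (hl _)).div_const 2

/-- Value iteration started at `0` converges to a fixed point of the Riccati operator. -/
theorem exists_posSemidef_riccati_eq (hQ : Q.PosSemidef) (hR : R.PosDef)
    {F : Matrix (Fin m) (Fin n) ℝ} (hF : IsStable (A + B * F)) :
    ∃ P : Matrix (Fin n) (Fin n) ℝ, P.PosSemidef ∧ P = riccati A B Q R P := by
  -- T is the cost matrix of the feedback F; it bounds every iterate because F is a competitor in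
  -- each minimization.
  obtain ⟨T, hT, hTeq⟩ := hF.exists_lyapunov
    (hQ.add (posSemidef_transpose_mul_mul hR.posSemidef F))
  have hTx (x : Fin n → ℝ) : x ⬝ᵥ T *ᵥ x = x ⬝ᵥ Q *ᵥ x + (F *ᵥ x) ⬝ᵥ R *ᵥ (F *ᵥ x)
      + (A *ᵥ x + B *ᵥ (F *ᵥ x)) ⬝ᵥ T *ᵥ (A *ᵥ x + B *ᵥ (F *ᵥ x)) := by
    conv_lhs => rw [hTeq]
    rw [add_mulVec, add_mulVec Q, dotProduct_add, dotProduct_add, dotProduct_mul_mulVec,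
      dotProduct_mul_mulVec, add_mulVec A, ← mulVec_mulVec]
    ring
  let X : ℕ → Matrix (Fin n) (Fin n) ℝ := fun k => (riccati A B Q R)^[k] 0
  have hX1 (k : ℕ) : X (k + 1) = riccati A B Q R (X k) := Function.iterate_succ_apply' _ _ _
  have hXpos (k : ℕ) : (X k).PosSemidef := by
    induction k with
    | zero => exact .zero
    | succ k ih => rw [hX1]; exact posSemidef_riccati hQ hR ih
  have hstep (k : ℕ) (x : Fin n → ℝ) : x ⬝ᵥ X k *ᵥ x ≤ x ⬝ᵥ X (k + 1) *ᵥ x := by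
    induction k generalizing x with
    | zero => simpa [X] using quadratic_nonneg (hXpos 1) x
    | succ k ih =>
      rw [hX1, hX1 (k + 1)]
      exact quadratic_riccati_mono hR (hXpos k) (hXpos (k + 1)) ih x
  have hbound (k : ℕ) (x : Fin n → ℝ) : x ⬝ᵥ X k *ᵥ x ≤ x ⬝ᵥ T *ᵥ x := by
    induction k generalizing x with
    | zero => simpa [X] using quadratic_nonneg hT x
    | succ k ih =>
      rw [hX1, hTx]
      refine (quadratic_riccati_le hR (hXpos k) x (F *ᵥ x)).trans ?_
      gcongr
      exact ih _
  obtain ⟨P, hP⟩ := exists_tendsto_of_quadratic_monotone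
    (fun k => transpose_eq_of_isHermitian (hXpos k).1)
    (fun x => monotone_nat_of_le_succ fun k => hstep k x) hbound
  have hPpos : P.PosSemidef := by
    refine posSemidef_of_quadratic_nonneg ?_ fun x => ?_
    · have hc : Continuous fun Y : Matrix (Fin n) (Fin n) ℝ => Yᵀ := by fun_prop
      refine tendsto_nhds_unique (((hc.tendsto P).comp hP).congr fun k => ?_) hP
      exact transpose_eq_of_isHermitian (hXpos k).1
    · have hc : Continuous fun Y : Matrix (Fin n) (Fin n) ℝ => x ⬝ᵥ Y *ᵥ x := by fun_prop
      exact ge_of_tendsto' ((hc.tendsto P).comp hP) fun k => quadratic_nonneg (hXpos k) x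
  refine ⟨P, hPpos, ?_⟩
  have h1 := (continuousAt_riccati (A := A) (B := B) (Q := Q) hR hPpos).tendsto.comp hP
  refine tendsto_nhds_unique ((tendsto_add_atTop_iff_nat 1).2 hP) (h1.congr fun k => ?_)
  exact (hX1 k).symm

variable (A B R P) in
/-- The states of a single system under the feedback with gain `gainK`. -/
def riccatiState (ξ : Fin n → ℝ) (k : ℕ) : Fin n → ℝ := (A + B * gainK A B R P) ^ k *ᵥ ξ

theorem riccatiState_zero (ξ : Fin n → ℝ) : riccatiState A B R P ξ 0 = ξ := by
  simp [riccatiState]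

theorem riccatiState_succ (ξ : Fin n → ℝ) (k : ℕ) :
    riccatiState A B R P ξ (k + 1) = A *ᵥ riccatiState A B R P ξ k
      + B *ᵥ (gainK A B R P *ᵥ riccatiState A B R P ξ k) := by
  rw [riccatiState, pow_succ', ← mulVec_mulVec, add_mulVec, ← mulVec_mulVec]
  rfl

theorem riccatiState_telescoping (hR : R.PosDef) (hP : P.PosSemidef)
    (hfix : P = riccati A B Q R P) (ξ : Fin n → ℝ) (k : ℕ) :
    riccatiState A B R P ξ k ⬝ᵥ P *ᵥ riccatiState A B R P ξ k =
      (riccatiState A B R P ξ k ⬝ᵥ Q *ᵥ riccatiState A B R P ξ k +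
        (gainK A B R P *ᵥ riccatiState A B R P ξ k) ⬝ᵥ R *ᵥ
          (gainK A B R P *ᵥ riccatiState A B R P ξ k)) +
      riccatiState A B R P ξ (k + 1) ⬝ᵥ P *ᵥ riccatiState A B R P ξ (k + 1) := by
  rw [riccatiState_succ, ← quadratic_riccati_eq hR hP, ← hfix]

theorem stageCost_nonneg (hQ : Q.PosSemidef) (hR : R.PosDef) (x : Fin n → ℝ) (u : Fin m → ℝ) :
    0 ≤ x ⬝ᵥ Q *ᵥ x + u ⬝ᵥ R *ᵥ u :=
  add_nonneg (quadratic_nonneg hQ x) (quadratic_nonneg hR.posSemidef u)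

/-- Any semidefinite fixed point is the exact cost of its own feedback; stability of that feedback
is derived, not assumed. -/
theorem hasSum_riccatiState (hobs : IsObservable A C) (hCQ : Cᵀ * C = Q) (hQ : Q.PosSemidef)
    (hR : R.PosDef) (hP : P.PosSemidef) (hfix : P = riccati A B Q R P) (ξ : Fin n → ℝ) :
    HasSum (fun k => riccatiState A B R P ξ k ⬝ᵥ Q *ᵥ riccatiState A B R P ξ k +
        (gainK A B R P *ᵥ riccatiState A B R P ξ k) ⬝ᵥ R *ᵥ
          (gainK A B R P *ᵥ riccatiState A B R P ξ k)) (ξ ⬝ᵥ P *ᵥ ξ) := by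
  have hs := summable_of_telescoping (fun k => stageCost_nonneg hQ hR _ _)
    (fun k => quadratic_nonneg hP _) (riccatiState_telescoping hR hP hfix ξ)
  have hlim := hobs.tendsto_zero_of_summable hCQ hQ hR (riccatiState_succ ξ) hs
  have := hasSum_of_telescoping (fun k => stageCost_nonneg hQ hR _ _)
    (tendsto_quadratic_zero P hlim) (riccatiState_telescoping hR hP hfix ξ)
  rwa [riccatiState_zero] at this

theorem quadratic_le_tsum_cost (hobs : IsObservable A C) (hCQ : Cᵀ * C = Q) (hQ : Q.PosSemidef)
    (hR : R.PosDef) (hP : P.PosSemidef) (hfix : P = riccati A B Q R P)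
    {x : ℕ → Fin n → ℝ} {u : ℕ → Fin m → ℝ} (hx : ∀ k, x (k + 1) = A *ᵥ x k + B *ᵥ u k)
    (hs : Summable fun k => x k ⬝ᵥ Q *ᵥ x k + u k ⬝ᵥ R *ᵥ u k) :
    x 0 ⬝ᵥ P *ᵥ x 0 ≤ ∑' k, (x k ⬝ᵥ Q *ᵥ x k + u k ⬝ᵥ R *ᵥ u k) := by
  refine le_tsum_of_telescoping (V := fun k => x k ⬝ᵥ P *ᵥ x k) hs
    (tendsto_quadratic_zero P (hobs.tendsto_zero_of_summable hCQ hQ hR hx hs)) fun k => ?_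
  have := quadratic_riccati_le (A := A) (B := B) (Q := Q) hR hP (x k) (u k)
  rwa [← hfix, ← hx] at this

/-- The form of `P'` is the cost of the feedback built from `P'`, and the form of `P` is a lower
bound for every finite cost. Exchanging the two matrices gives uniqueness. -/
theorem quadratic_le_of_riccati_eq (hobs : IsObservable A C) (hCQ : Cᵀ * C = Q)
    (hQ : Q.PosSemidef) (hR : R.PosDef) (hP : P.PosSemidef) (hfix : P = riccati A B Q R P)
    {P' : Matrix (Fin n) (Fin n) ℝ} (hP' : P'.PosSemidef) (hfix' : P' = riccati A B Q R P')
    (ξ : Fin n → ℝ) : ξ ⬝ᵥ P *ᵥ ξ ≤ ξ ⬝ᵥ P' *ᵥ ξ := by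
  have h := hasSum_riccatiState hobs hCQ hQ hR hP' hfix' ξ
  have hle := quadratic_le_tsum_cost hobs hCQ hQ hR hP hfix (riccatiState_succ ξ) h.summable
  rwa [riccatiState_zero, h.tsum_eq] at hle

/-- Uniqueness of the positive semidefinite fixed point of the Riccati operator. -/
theorem riccati_eq_unique (hobs : IsObservable A C) (hCQ : Cᵀ * C = Q)
    (hQ : Q.PosSemidef) (hR : R.PosDef) (hP : P.PosSemidef) (hfix : P = riccati A B Q R P)
    {P' : Matrix (Fin n) (Fin n) ℝ} (hP' : P'.PosSemidef) (hfix' : P' = riccati A B Q R P') :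
    P = P' :=
  ext_of_quadratic_eq (transpose_eq_of_isHermitian hP.1) (transpose_eq_of_isHermitian hP'.1)
    fun ξ => le_antisymm (quadratic_le_of_riccati_eq hobs hCQ hQ hR hP hfix hP' hfix' ξ)
      (quadratic_le_of_riccati_eq hobs hCQ hQ hR hP' hfix' hP hfix ξ)

theorem posDef_of_riccati_eq (hobs : IsObservable A C) (hCQ : Cᵀ * C = Q)
    (hQ : Q.PosSemidef) (hR : R.PosDef) (hP : P.PosSemidef) (hfix : P = riccati A B Q R P) :
    P.PosDef := by
  refine posDef_of_quadratic_pos (transpose_eq_of_isHermitian hP.1) fun ξ hξ =>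
    (quadratic_nonneg hP ξ).lt_of_ne' fun h0 => hξ ?_
  -- Zero total cost forces every stage cost to vanish, hence all inputs are 0 (R > 0), the
  -- trajectory is free, and its output is 0.
  have hsum := hasSum_riccatiState hobs hCQ hQ hR hP hfix ξ
  rw [h0, hasSum_zero_iff_of_nonneg fun k => stageCost_nonneg hQ hR _ _] at hsum
  have hstage (k : ℕ) := congrFun hsum k
  simp only [Pi.zero_apply] at hstage
  have hu (k : ℕ) : gainK A B R P *ᵥ riccatiState A B R P ξ k = 0 := by
    by_contra hne
    have := quadratic_pos hR hne
    have := quadratic_nonneg hQ (riccatiState A B R P ξ k)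
    linarith [hstage k]
  have hxk (k : ℕ) : riccatiState A B R P ξ k = A ^ k *ᵥ ξ := by
    induction k with
    | zero => simp [riccatiState_zero]
    | succ k ih => rw [riccatiState_succ, hu, ih, mulVec_zero, add_zero, mulVec_mulVec, pow_succ']
  refine hobs ξ fun k => ?_
  have h := hstage k
  rw [hu, mulVec_zero, dotProduct_zero, add_zero, quadratic_gram hCQ,
    dotProduct_self_eq_zero, hxk] at h
  exact h

end AlgebraicRiccati

/-! ### The coupled equations: a Riccati equation, then a Lyapunov equation. -/

section CoupledEquations

variable {n m p : ℕ} {A : Matrix (Fin n) (Fin n) ℝ} {B : Matrix (Fin n) (Fin m) ℝ}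
  {Q : Matrix (Fin n) (Fin n) ℝ} {R : Matrix (Fin m) (Fin m) ℝ} {C : Matrix (Fin p) (Fin n) ℝ}
  {Fbar : Matrix (Fin m) (Fin n) ℝ} {P Pbar : Matrix (Fin n) (Fin n) ℝ}

/-- Working form of the system: given P, the equation for `Pbar` is a Lyapunov equation with a
positive semidefinite source. -/
theorem isPosDefSolution_iff (hR : R.PosDef) :
    IsPosDefSolution A B Fbar Q R P Pbar ↔
      P.PosDef ∧ Pbar.PosSemidef ∧ P = riccati A B Q R P ∧
        Pbar = (A + B * Fbar)ᵀ * Pbar * (A + B * Fbar) +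
          (gainKbar A B Fbar R P)ᵀ * (R + Bᵀ * P * B) * gainKbar A B Fbar R P := by
  rw [IsPosDefSolution, SolvesARE, add_sub_cancel_left]
  constructor
  · rintro ⟨⟨h1, h2⟩, hP, hPbar⟩
    refine ⟨hP, hPbar, h1, ?_⟩
    rw [← gainKbar_square Fbar hR hP.posSemidef]
    simpa only [add_assoc] using h2
  · rintro ⟨hP, hPbar, h1, h2⟩
    refine ⟨⟨h1, ?_⟩, hP, hPbar⟩
    rw [← gainKbar_square Fbar hR hP.posSemidef] at h2
    simpa only [add_assoc] using h2

theorem existsUnique_isPosDefSolution (hobs : IsObservable A C) (hCQ : Cᵀ * C = Q)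
    (hQ : Q.PosSemidef) (hR : R.PosDef) (hF : IsStable (A + B * Fbar)) :
    ∃! X : Matrix (Fin n) (Fin n) ℝ × Matrix (Fin n) (Fin n) ℝ,
      IsPosDefSolution A B Fbar Q R X.1 X.2 := by
  obtain ⟨P, hP, hfix⟩ := exists_posSemidef_riccati_eq hQ hR hF
  obtain ⟨Pbar, hPbar, hlyap⟩ := hF.exists_lyapunov (posSemidef_transpose_mul_mul
    (posDef_inputWeight (B := B) hR hP).posSemidef (gainKbar A B Fbar R P))
  refine ⟨(P, Pbar), (isPosDefSolution_iff hR).2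
    ⟨posDef_of_riccati_eq hobs hCQ hQ hR hP hfix, hPbar, hfix, hlyap⟩, ?_⟩
  rintro ⟨P', Pbar'⟩ h
  obtain ⟨hP', -, hfix', hlyap'⟩ := (isPosDefSolution_iff hR).1 h
  obtain rfl := riccati_eq_unique hobs hCQ hQ hR hP hfix hP'.posSemidef hfix'
  -- With P fixed, the sources agree, so the difference of two candidates solves the homogeneous
  -- Lyapunov equation.
  refine Prod.ext rfl (sub_eq_zero.1 (hF.eq_zero_of_lyapunov ?_))
  dsimp only at hlyap' ⊢
  rw [Matrix.mul_sub, Matrix.sub_mul]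
  conv_lhs => rw [hlyap, hlyap', add_sub_add_right_eq_sub]

end CoupledEquations

/-! ### Weighted averages and Cauchy-Schwarz. -/

section Average

variable {v d e : ℕ} (μ : Fin v → ℝ)

theorem average_mulVec (M : Matrix (Fin e) (Fin d) ℝ) (z : Fin v → Fin d → ℝ) :
    average μ (fun i => M *ᵥ z i) = M *ᵥ average μ z := by
  simp only [average, ← mulVec_smul, mulVec_sum]

theorem average_add (z w : Fin v → Fin d → ℝ) :
    average μ (fun i => z i + w i) = average μ z + average μ w := by
  simp only [average, smul_add, Finset.sum_add_distrib]

theorem average_sub (z w : Fin v → Fin d → ℝ) :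
    average μ (fun i => z i - w i) = average μ z - average μ w := by
  simp only [average, smul_sub, Finset.sum_sub_distrib]

variable {μ} in
-- A right inverse of the average. It supplies both initial states with a prescribed average and the
-- weights of the optimal feedback.
theorem average_weight_smul (hμ : ∑ j, μ j ^ 2 ≠ 0) (y : Fin d → ℝ) :
    average μ (fun i => (μ i / ∑ j, μ j ^ 2) • y) = y := by
  simp only [average, smul_smul, ← Finset.sum_smul, mul_div_assoc', ← sq, ← Finset.sum_div]
  rw [div_self hμ, one_smul]

theorem tendsto_average_zero {z : ℕ → Fin v → Fin d → ℝ}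
    (hz : ∀ i, Tendsto (fun k => z k i) atTop (𝓝 0)) :
    Tendsto (fun k => average μ (z k)) atTop (𝓝 0) := by
  have := tendsto_finsetSum Finset.univ fun i _ => (hz i).const_smul (μ i)
  simpa [average] using this

variable {μ} in
/-- The excess in the Cauchy-Schwarz inequality for the weighted average, as a sum of squares. -/
theorem sum_quadratic_sub_average {S : Matrix (Fin d) (Fin d) ℝ} (hS : Sᵀ = S)
    (hμ : ∑ j, μ j ^ 2 ≠ 0) (w : Fin v → Fin d → ℝ) :
    ∑ i, (w i - (μ i / ∑ j, μ j ^ 2) • average μ w) ⬝ᵥ S *ᵥ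
        (w i - (μ i / ∑ j, μ j ^ 2) • average μ w) =
      ∑ i, w i ⬝ᵥ S *ᵥ w i
        - (1 / ∑ j, μ j ^ 2) * (average μ w ⬝ᵥ S *ᵥ average μ w) := by
  set c := ∑ j, μ j ^ 2 with hc
  set a := average μ w with ha
  have hterm (i : Fin v) : (w i - (μ i / c) • a) ⬝ᵥ S *ᵥ (w i - (μ i / c) • a) =
      w i ⬝ᵥ S *ᵥ w i - 2 / c * (a ⬝ᵥ S *ᵥ (μ i • w i))
        + μ i ^ 2 * ((a ⬝ᵥ S *ᵥ a) / c ^ 2) := by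
    rw [sub_eq_add_neg, quadratic_add hS]
    simp only [neg_dotProduct, mulVec_neg, dotProduct_neg, mulVec_smul, dotProduct_smul,
      smul_dotProduct, smul_eq_mul]
    ring
  simp only [hterm, Finset.sum_add_distrib, Finset.sum_sub_distrib, ← Finset.mul_sum,
    ← Finset.sum_mul, ← dotProduct_sum, ← mulVec_sum]
  rw [← hc, show ∑ i, μ i • w i = a from rfl]
  field_simp
  ring

end Average

/-! ### The constrained problem for the coupled subsystems. -/

section Distributed

variable {n m v p : ℕ} {A : Matrix (Fin n) (Fin n) ℝ} {B : Matrix (Fin n) (Fin m) ℝ}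
  {Q : Matrix (Fin n) (Fin n) ℝ} {R : Matrix (Fin m) (Fin m) ℝ} {C : Matrix (Fin p) (Fin n) ℝ}
  {Fbar : Matrix (Fin m) (Fin n) ℝ} {P Pbar : Matrix (Fin n) (Fin n) ℝ} {μ : Fin v → ℝ}

theorem average_step {z : Fin v → Fin n → ℝ} {w : Fin v → Fin m → ℝ}
    (hw : average μ w = Fbar *ᵥ average μ z) :
    average μ (fun i => A *ᵥ z i + B *ᵥ w i) = (A + B * Fbar) *ᵥ average μ z := by
  rw [average_add, average_mulVec, average_mulVec, hw, add_mulVec, mulVec_mulVec]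

/-- The deviation of the inputs from the optimal feedback law. -/
def deviation (μ : Fin v → ℝ) (K Kbar : Matrix (Fin m) (Fin n) ℝ) (z : Fin v → Fin n → ℝ)
    (w : Fin v → Fin m → ℝ) (i : Fin v) : Fin m → ℝ :=
  w i - K *ᵥ z i - (μ i / ∑ j, μ j ^ 2) • (Kbar *ᵥ average μ z)

/-- One step of dynamic programming under the constraint: the loss of value is the stage cost minus
the squared deviation from the optimal feedback. -/
theorem optimalValue_step (hμ : ∑ j, μ j ^ 2 ≠ 0) (hR : R.PosDef)
    (hsol : IsPosDefSolution A B Fbar Q R P Pbar) {z : Fin v → Fin n → ℝ} {w : Fin v → Fin m → ℝ}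
    (hw : average μ w = Fbar *ᵥ average μ z) :
    optimalValue μ P Pbar z +
        ∑ i, deviation μ (gainK A B R P) (gainKbar A B Fbar R P) z w i ⬝ᵥ (R + Bᵀ * P * B) *ᵥ
          deviation μ (gainK A B R P) (gainKbar A B Fbar R P) z w i =
      ∑ i, (z i ⬝ᵥ Q *ᵥ z i + w i ⬝ᵥ R *ᵥ w i)
        + optimalValue μ P Pbar (fun i => A *ᵥ z i + B *ᵥ w i) := by
  obtain ⟨hP, -, hfix, hlyap⟩ := (isPosDefSolution_iff hR).1 hsol
  set S := R + Bᵀ * P * B with hSdef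
  set K := gainK A B R P with hK
  set Kbar := gainKbar A B Fbar R P with hKbar
  have hS : Sᵀ = S := transpose_eq_of_isHermitian (posDef_inputWeight hR hP.posSemidef).1
  -- Here the constraint enters: as Kbar = Fbar - K, it fixes the average of the deviations from K
  -- z, so their excess over Cauchy-Schwarz is exactly the sum of squared deviations from the
  -- optimal feedback.
  have havg : average μ (fun i => w i - K *ᵥ z i) = Kbar *ᵥ average μ z := by
    rw [average_sub, average_mulVec, hw, hKbar, gainKbar, sub_mulVec]
  have hcs := sum_quadratic_sub_average hS hμ fun i => w i - K *ᵥ z i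
  rw [havg] at hcs
  have hsq : ∑ i, (z i ⬝ᵥ Q *ᵥ z i + w i ⬝ᵥ R *ᵥ w i)
      + ∑ i, (A *ᵥ z i + B *ᵥ w i) ⬝ᵥ P *ᵥ (A *ᵥ z i + B *ᵥ w i)
      = ∑ i, z i ⬝ᵥ P *ᵥ z i + ∑ i, (w i - K *ᵥ z i) ⬝ᵥ S *ᵥ (w i - K *ᵥ z i) := by
    rw [← Finset.sum_add_distrib, ← Finset.sum_add_distrib]
    refine Finset.sum_congr rfl fun i _ => ?_
    rw [complete_square hR hP.posSemidef, ← hfix]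
  have hbar : average μ z ⬝ᵥ Pbar *ᵥ average μ z =
      ((A + B * Fbar) *ᵥ average μ z) ⬝ᵥ Pbar *ᵥ ((A + B * Fbar) *ᵥ average μ z)
        + (Kbar *ᵥ average μ z) ⬝ᵥ S *ᵥ (Kbar *ᵥ average μ z) := by
    conv_lhs => rw [hlyap]
    rw [add_mulVec, dotProduct_add, dotProduct_mul_mulVec, dotProduct_mul_mulVec]
  simp only [deviation, optimalValue, average_step hw]
  rw [hcs, hbar]
  linear_combination hsq.symm

theorem optimalValue_nonneg (hP : P.PosDef) (hPbar : Pbar.PosSemidef) (z : Fin v → Fin n → ℝ) :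
    0 ≤ optimalValue μ P Pbar z := by
  have h1 : 0 ≤ ∑ i, z i ⬝ᵥ P *ᵥ z i :=
    Finset.sum_nonneg fun i _ => quadratic_nonneg hP.posSemidef _
  have h2 := quadratic_nonneg hPbar (average μ z)
  have h3 : 0 ≤ ∑ j, μ j ^ 2 := Finset.sum_nonneg fun j _ => sq_nonneg _
  unfold optimalValue
  positivity

theorem tendsto_optimalValue_zero {x : ℕ → Fin v → Fin n → ℝ}
    (hx : ∀ i, Tendsto (fun k => x k i) atTop (𝓝 0)) :
    Tendsto (fun k => optimalValue μ P Pbar (x k)) atTop (𝓝 0) := by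
  have h1 := tendsto_finsetSum Finset.univ fun i _ => tendsto_quadratic_zero P (hx i)
  have h2 := (tendsto_quadratic_zero Pbar (tendsto_average_zero μ hx)).const_mul
    (1 / ∑ j, μ j ^ 2)
  simpa [optimalValue] using h1.add h2

theorem cost_eq_tsum (hQ : Q.PosSemidef) (hR : R.PosDef) (x : ℕ → Fin v → Fin n → ℝ)
    (u : ℕ → Fin v → Fin m → ℝ) :
    cost Q R x u =
      ∑' k, ENNReal.ofReal (∑ i, (x k i ⬝ᵥ Q *ᵥ x k i + u k i ⬝ᵥ R *ᵥ u k i)) := by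
  rw [cost, ← Summable.tsum_finsetSum fun _ _ => ENNReal.summable]
  exact tsum_congr fun k => (ENNReal.ofReal_sum_of_nonneg fun i _ => stageCost_nonneg hQ hR _ _).symm

theorem sum_stageCost_nonneg (hQ : Q.PosSemidef) (hR : R.PosDef) (z : Fin v → Fin n → ℝ)
    (w : Fin v → Fin m → ℝ) : 0 ≤ ∑ i, (z i ⬝ᵥ Q *ᵥ z i + w i ⬝ᵥ R *ᵥ w i) :=
  Finset.sum_nonneg fun _ _ => stageCost_nonneg hQ hR _ _

theorem IsObservable.tendsto_zero_of_summable_sum (hobs : IsObservable A C) (hCQ : Cᵀ * C = Q)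
    (hQ : Q.PosSemidef) (hR : R.PosDef) {x : ℕ → Fin v → Fin n → ℝ} {u : ℕ → Fin v → Fin m → ℝ}
    (hx : ∀ k i, x (k + 1) i = A *ᵥ x k i + B *ᵥ u k i)
    (hs : Summable fun k => ∑ i, (x k i ⬝ᵥ Q *ᵥ x k i + u k i ⬝ᵥ R *ᵥ u k i)) (i : Fin v) :
    Tendsto (fun k => x k i) atTop (𝓝 0) := by
  refine hobs.tendsto_zero_of_summable hCQ hQ hR (u := fun k => u k i) (fun k => hx k i)
    (hs.of_nonneg_of_le (fun k => stageCost_nonneg hQ hR _ _) fun k => ?_)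
  exact Finset.single_le_sum (f := fun i => x k i ⬝ᵥ Q *ᵥ x k i + u k i ⬝ᵥ R *ᵥ u k i)
    (fun i _ => stageCost_nonneg hQ hR _ _) (Finset.mem_univ i)

/-- The claimed optimal value bounds the cost of every admissible control from below. -/
theorem optimalValue_le_cost (hμ : ∑ j, μ j ^ 2 ≠ 0) (hobs : IsObservable A C)
    (hCQ : Cᵀ * C = Q) (hQ : Q.PosSemidef) (hR : R.PosDef)
    (hsol : IsPosDefSolution A B Fbar Q R P Pbar) {ξ : Fin v → Fin n → ℝ}
    {x : ℕ → Fin v → Fin n → ℝ} {u : ℕ → Fin v → Fin m → ℝ} (hx : IsTrajectory A B ξ x u)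
    (hu : SatisfiesConstraint μ Fbar x u) :
    (optimalValue μ P Pbar ξ : EReal) ≤ (cost Q R x u : EReal) := by
  obtain ⟨hP, -, -, -⟩ := (isPosDefSolution_iff hR).1 hsol
  have h0 (k : ℕ) := sum_stageCost_nonneg hQ hR (x k) (u k)
  rw [cost_eq_tsum hQ hR]
  -- Finite cost makes the states, hence the value, tend to 0, as the telescoping bound requires;
  -- otherwise the cost is ⊤.
  by_cases hs : Summable fun k => ∑ i, (x k i ⬝ᵥ Q *ᵥ x k i + u k i ⬝ᵥ R *ᵥ u k i)
  · have hle : optimalValue μ P Pbar ξ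
        ≤ ∑' k, ∑ i, (x k i ⬝ᵥ Q *ᵥ x k i + u k i ⬝ᵥ R *ᵥ u k i) := by
      rw [← hx.1]
      refine le_tsum_of_telescoping (V := fun k => optimalValue μ P Pbar (x k)) hs
        (tendsto_optimalValue_zero (hobs.tendsto_zero_of_summable_sum hCQ hQ hR hx.2 hs))
        fun k => ?_
      have hstep := optimalValue_step hμ hR hsol (hu k)
      rw [← show x (k + 1) = fun i => A *ᵥ x k i + B *ᵥ u k i from funext (hx.2 k)] at hstep
      rw [← hstep]
      exact le_add_of_nonneg_right (Finset.sum_nonneg fun i _ =>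
        quadratic_nonneg (posDef_inputWeight hR hP.posSemidef).posSemidef _)
    rw [← ENNReal.ofReal_tsum_of_nonneg h0 hs, EReal.coe_ennreal_ofReal]
    exact EReal.coe_le_coe_iff.2 (hle.trans (le_max_left _ _))
  · have htop : ∑' k, ENNReal.ofReal (∑ i, (x k i ⬝ᵥ Q *ᵥ x k i + u k i ⬝ᵥ R *ᵥ u k i)) = ⊤ := by
      by_contra hne
      refine hs ((ENNReal.summable_toReal hne).congr fun k => ?_)
      exact ENNReal.toReal_ofReal (h0 k)
    rw [htop]
    simp

theorem isTrajectory_closedLoop (L Lbar : Fin v → Matrix (Fin m) (Fin n) ℝ)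
    (ξ : Fin v → Fin n → ℝ) :
    IsTrajectory A B ξ (closedLoopState A B μ L Lbar ξ) (closedLoopInput A B μ L Lbar ξ) :=
  ⟨rfl, fun _ _ => rfl⟩

/-- The constraint alone determines the average trajectory, whatever the gains. -/
theorem average_closedLoopState {L Lbar : Fin v → Matrix (Fin m) (Fin n) ℝ}
    {ξ : Fin v → Fin n → ℝ}
    (hc : SatisfiesConstraint μ Fbar (closedLoopState A B μ L Lbar ξ)
      (closedLoopInput A B μ L Lbar ξ)) (k : ℕ) :
    average μ (closedLoopState A B μ L Lbar ξ k) = (A + B * Fbar) ^ k *ᵥ average μ ξ := by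
  induction k with
  | zero => simp [closedLoopState]
  | succ k ih =>
    rw [pow_succ', ← mulVec_mulVec, ← ih]
    exact average_step (hc k)

theorem isStable_of_stabilizable (hμ : ∑ j, μ j ^ 2 ≠ 0) (h : Stabilizable A B μ Fbar) :
    IsStable (A + B * Fbar) := by
  obtain ⟨L, Lbar, h⟩ := h
  refine isStable_of_tendsto_pow fun y => ?_
  obtain ⟨hc, hlim⟩ := h fun i => (μ i / ∑ j, μ j ^ 2) • y
  have := tendsto_average_zero μ hlim
  simpa only [average_closedLoopState hc, average_weight_smul hμ] using this

section OptimalFeedback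

variable {L Lbar : Fin v → Matrix (Fin m) (Fin n) ℝ}

/-- The weights average to the identity, leaving K + Kbar = Fbar. -/
theorem average_feedback (hμ : ∑ j, μ j ^ 2 ≠ 0) (hL : L = fun _ => gainK A B R P)
    (hLbar : Lbar = fun i => (μ i / ∑ j, μ j ^ 2) • gainKbar A B Fbar R P)
    (z : Fin v → Fin n → ℝ) : average μ (feedback μ L Lbar z) = Fbar *ᵥ average μ z := by
  subst hL hLbar
  unfold feedback
  simp only [smul_mulVec]
  rw [average_add, average_mulVec, average_weight_smul hμ, gainKbar, sub_mulVec,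
    add_sub_cancel]

theorem deviation_feedback (hL : L = fun _ => gainK A B R P)
    (hLbar : Lbar = fun i => (μ i / ∑ j, μ j ^ 2) • gainKbar A B Fbar R P)
    (z : Fin v → Fin n → ℝ) (i : Fin v) :
    deviation μ (gainK A B R P) (gainKbar A B Fbar R P) z (feedback μ L Lbar z) i = 0 := by
  subst hL hLbar
  simp [deviation, feedback, smul_mulVec]

theorem optimalValue_closedLoop (hμ : ∑ j, μ j ^ 2 ≠ 0) (hR : R.PosDef)
    (hsol : IsPosDefSolution A B Fbar Q R P Pbar) (hL : L = fun _ => gainK A B R P)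
    (hLbar : Lbar = fun i => (μ i / ∑ j, μ j ^ 2) • gainKbar A B Fbar R P)
    (ξ : Fin v → Fin n → ℝ) (k : ℕ) :
    optimalValue μ P Pbar (closedLoopState A B μ L Lbar ξ k) =
      ∑ i, (closedLoopState A B μ L Lbar ξ k i ⬝ᵥ Q *ᵥ closedLoopState A B μ L Lbar ξ k i +
        closedLoopInput A B μ L Lbar ξ k i ⬝ᵥ R *ᵥ closedLoopInput A B μ L Lbar ξ k i)
      + optimalValue μ P Pbar (closedLoopState A B μ L Lbar ξ (k + 1)) := by
  have h := optimalValue_step hμ hR hsol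
    (average_feedback (A := A) (B := B) (R := R) (P := P) hμ hL hLbar
      (closedLoopState A B μ L Lbar ξ k))
  simp only [deviation_feedback hL hLbar, zero_dotProduct, Finset.sum_const_zero, add_zero] at h
  exact h

/-- The deviation vanishes under this feedback, so the nonnegative value bounds the accumulated
cost; observability does the rest. -/
theorem tendsto_closedLoopState (hμ : ∑ j, μ j ^ 2 ≠ 0) (hobs : IsObservable A C)
    (hCQ : Cᵀ * C = Q) (hQ : Q.PosSemidef) (hR : R.PosDef)
    (hsol : IsPosDefSolution A B Fbar Q R P Pbar) (hL : L = fun _ => gainK A B R P)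
    (hLbar : Lbar = fun i => (μ i / ∑ j, μ j ^ 2) • gainKbar A B Fbar R P)
    (ξ : Fin v → Fin n → ℝ) (i : Fin v) :
    Tendsto (fun k => closedLoopState A B μ L Lbar ξ k i) atTop (𝓝 0) := by
  obtain ⟨hP, hPbar, -, -⟩ := (isPosDefSolution_iff hR).1 hsol
  exact hobs.tendsto_zero_of_summable_sum hCQ hQ hR (isTrajectory_closedLoop L Lbar ξ).2
    (summable_of_telescoping (fun k => sum_stageCost_nonneg hQ hR _ _)
      (fun k => optimalValue_nonneg hP hPbar _)
      (optimalValue_closedLoop hμ hR hsol hL hLbar ξ)) i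

theorem stabilizes_of_isPosDefSolution (hμ : ∑ j, μ j ^ 2 ≠ 0) (hobs : IsObservable A C)
    (hCQ : Cᵀ * C = Q) (hQ : Q.PosSemidef) (hR : R.PosDef)
    (hsol : IsPosDefSolution A B Fbar Q R P Pbar) (hL : L = fun _ => gainK A B R P)
    (hLbar : Lbar = fun i => (μ i / ∑ j, μ j ^ 2) • gainKbar A B Fbar R P) :
    Stabilizes A B μ Fbar L Lbar := fun ξ =>
  ⟨fun _ => average_feedback hμ hL hLbar _,
    tendsto_closedLoopState hμ hobs hCQ hQ hR hsol hL hLbar ξ⟩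

theorem cost_closedLoop (hμ : ∑ j, μ j ^ 2 ≠ 0) (hobs : IsObservable A C)
    (hCQ : Cᵀ * C = Q) (hQ : Q.PosSemidef) (hR : R.PosDef)
    (hsol : IsPosDefSolution A B Fbar Q R P Pbar) (hL : L = fun _ => gainK A B R P)
    (hLbar : Lbar = fun i => (μ i / ∑ j, μ j ^ 2) • gainKbar A B Fbar R P)
    (ξ : Fin v → Fin n → ℝ) :
    (cost Q R (closedLoopState A B μ L Lbar ξ) (closedLoopInput A B μ L Lbar ξ) : EReal)
      = (optimalValue μ P Pbar ξ : EReal) := by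
  obtain ⟨hP, hPbar, -, -⟩ := (isPosDefSolution_iff hR).1 hsol
  have hnn (k : ℕ) := sum_stageCost_nonneg hQ hR (closedLoopState A B μ L Lbar ξ k)
    (closedLoopInput A B μ L Lbar ξ k)
  have hsum := hasSum_of_telescoping hnn
    (tendsto_optimalValue_zero (tendsto_closedLoopState hμ hobs hCQ hQ hR hsol hL hLbar ξ))
    (optimalValue_closedLoop hμ hR hsol hL hLbar ξ)
  rw [cost_eq_tsum hQ hR, ← ENNReal.ofReal_tsum_of_nonneg hnn hsum.summable, hsum.tsum_eq,
    EReal.coe_ennreal_ofReal, max_eq_left (optimalValue_nonneg hP hPbar _)]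
  rfl

end OptimalFeedback

end Distributed

end

end DistributedLQ

theorem theorem2 {n m v p : ℕ}
    (A : Matrix (Fin n) (Fin n) ℝ) (B : Matrix (Fin n) (Fin m) ℝ)
    (Q : Matrix (Fin n) (Fin n) ℝ) (R : Matrix (Fin m) (Fin m) ℝ)
    (C : Matrix (Fin p) (Fin n) ℝ) (Fbar : Matrix (Fin m) (Fin n) ℝ)
    (μ : Fin v → ℝ) (hμ : ∑ j, μ j ^ 2 ≠ 0)
    (hQ : Q.PosSemidef) (hR : R.PosDef)
    (hCQ : Cᵀ * C = Q) (hobs : DistributedLQ.IsObservable A C) :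
    List.TFAE
      [DistributedLQ.Stabilizable A B μ Fbar,
       DistributedLQ.IsStable (A + B * Fbar),
       ∃! X : Matrix (Fin n) (Fin n) ℝ × Matrix (Fin n) (Fin n) ℝ,
         DistributedLQ.IsPosDefSolution A B Fbar Q R X.1 X.2] ∧
    ∀ P Pbar : Matrix (Fin n) (Fin n) ℝ,
      DistributedLQ.IsPosDefSolution A B Fbar Q R P Pbar →
      ∀ L Lbar : Fin v → Matrix (Fin m) (Fin n) ℝ,
        (L = fun _ => DistributedLQ.gainK A B R P) →
        (Lbar = fun i => (μ i / ∑ j, μ j ^ 2) • DistributedLQ.gainKbar A B Fbar R P) →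
        DistributedLQ.Stabilizes A B μ Fbar L Lbar ∧
        ∀ ξ : Fin v → Fin n → ℝ,
          (DistributedLQ.cost Q R (DistributedLQ.closedLoopState A B μ L Lbar ξ)
              (DistributedLQ.closedLoopInput A B μ L Lbar ξ) : EReal)
            = (DistributedLQ.optimalValue μ P Pbar ξ : EReal) ∧
          ∀ (x : ℕ → Fin v → Fin n → ℝ) (u : ℕ → Fin v → Fin m → ℝ),
            DistributedLQ.IsTrajectory A B ξ x u →
            DistributedLQ.SatisfiesConstraint μ Fbar x u →
            (DistributedLQ.optimalValue μ P Pbar ξ : EReal) ≤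
              (DistributedLQ.cost Q R x u : EReal) := by
  open DistributedLQ in
  refine ⟨?_, fun P Pbar hsol L Lbar hL hLbar =>
    ⟨stabilizes_of_isPosDefSolution hμ hobs hCQ hQ hR hsol hL hLbar, fun ξ =>
      ⟨cost_closedLoop hμ hobs hCQ hQ hR hsol hL hLbar ξ, fun x u hx hu =>
        optimalValue_le_cost hμ hobs hCQ hQ hR hsol hx hu⟩⟩⟩
  tfae_have 1 → 2 := DistributedLQ.isStable_of_stabilizable hμ
  tfae_have 2 → 3 := DistributedLQ.existsUnique_isPosDefSolution hobs hCQ hQ hR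
  -- Existence of a solution suffices here; uniqueness is discarded.
  tfae_have 3 → 1 := fun ⟨_, hsol, _⟩ =>
    ⟨_, _, DistributedLQ.stabilizes_of_isPosDefSolution hμ hobs hCQ hQ hR hsol rfl rfl⟩
  tfae_finish
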